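/- **Setting.** Let $d\ge 1$. A generalized linear model with covariates in $\mathbb R^d$ is given by a $\sigma$-finite measure $\nu$ on $\mathbb R$, a dispersion value $c(\sigma)>0$, a measurable $h(\cdot,\sigma)\ge 0$, a twice continuously differentiable $\psi:\mathbb R\to\mathbb R$ such that for every $u\in\mathbb R$ the function $y\mapsto h(y,\sigma)\exp\{(yu-\psi(u))/c(\sigma)\}$ is a probability density with respect to $\nu$, and a probability law $f_{\boldsymbol x}$ on $\mathbb R^d$. For $\beta\in\mathbb R^d$, an observation $(y,\boldsymbol x)$ consists of $\boldsymbol x\sim f_{\boldsymbol x}$ and, given $\boldsymbol x$, a response $y$ with $\nu$-density $$f_\beta(y\mid \boldsymbol x)=h(y,\sigma)\exp\Big(\frac{y\,\boldsymbol x^\top\beta-\psi(\boldsymbol x^\top\beta)}{c(\sigma)}\Big).$$ All components except $\beta$ are known. A randomized algorithm $M$ on data sets of $n$ records is $(\varepsilon,\delta)$-differentially private if $\mathbb P(M(\boldsymbol Z)\in S)\le e^{\varepsilon}\,\mathbb P(M(\boldsymbol Z')\in S)+\delta$ for all data sets $\boldsymbol Z,\boldsymbol Z'$ differing in one record and all measurable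 $S$; $\mathcal M_{\varepsilon,\delta}$ is the set of such algorithms mapping $(\mathbb R\times\mathbb R^d)^n$ to $\mathbb R^d$. $\|\beta\|_0$ is the number of nonzero coordinates of $\beta$. **Theorem 5.1.** Let $\gamma_1,\gamma_2,\kappa,K_1,K_2,C,c_1,c_2>0$. There is a constant $c_0>0$ depending only on these numbers such that the following holds for all integers $n\ge 1$ and $1\le s^*\le d$, all real $\varepsilon,\delta$ and every generalized linear model as above. Suppose that - $s^*\le \kappa\, d^{1-\gamma_1}$ (in particular this covers $s^*=o(d^{1-\gamma_1})$); - $\mathbb E(\boldsymbol x\boldsymbol x^\top)$ is diagonal with $\lambda_{\max}(\mathbb E(\boldsymbol x\boldsymbol x^\top))<C$, $\|\boldsymbol x\|_\infty<c_1$ almost surely, and $|\psi''|\le c_2$ on $\mathbb R$; - $0<\varepsilon<1$, $\delta\ge 0$, $s^*\log(d/s^*)\le K_1 n\varepsilon$ and $\delta\le K_2 n^{-(1+\gamma_2)}$. Then, for $n$ i.i.d. observations $(\boldsymbol y,\boldsymbol X)=\{(y_i,\boldsymbol x_i)\}_{i=1}^n$ from the model, $$\inf_{M\in\mathcal M_{\varepsilon,\delta}}\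 \sup_{\beta\in\mathbb R^d,\ \|\beta\|_0\le s^*}\mathbb E\|M(\boldsymbol y,\boldsymbol X)-\beta\|_2^2\ \ge\ c_0\,c(\sigma)\left(\frac{s^*\log(d/s^*)}{n}+\frac{(s^*\log(d/s^*))^2}{n^2\varepsilon^2}\right),$$ where the expectation is over the sample and the randomness of $M$ and may be $+\infty$. -/

import Mathlib

open MeasureTheory ProbabilityTheory
open scoped ENNReal

noncomputable section

/-- A generalized linear model with covariates in `ℝ^d`.  Given the covariate vector `x`, the
response `y ∈ ℝ` has density `h(y, σ) exp ((y u - ψ u) / c(σ))`, `u = xᵀβ`, with respect to the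
fixed dominating measure `base` (Lebesgue measure for continuous responses, a counting measure for
discrete ones), and `x` has the law `design`.  Everything here is known; only `β` is unknown. -/
structure GLM (d : ℕ) where
  /-- dominating measure for the responses -/
  base : Measure ℝ
  base_sigmaFinite : SigmaFinite base
  /-- dispersion parameter -/
  σ : ℝ
  /-- dispersion function -/
  c : ℝ → ℝ
  /-- normalizing factor `h(y, σ)` -/
  h : ℝ → ℝ → ℝ
  /-- partition function -/
  ψ : ℝ → ℝ
  /-- law of the covariate vector -/
  design : Measure (EuclideanSpace ℝ (Fin d))
  design_isProbabilityMeasure : IsProbabilityMeasure design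
  c_pos : 0 < c σ
  h_nonneg : ∀ y, 0 ≤ h y σ
  h_measurable : Measurable fun y => h y σ
  ψ_contDiff : ContDiff ℝ 2 ψ
  /-- each `h(y, σ) exp ((y u - ψ u) / c(σ))` is a probability density in `y` -/
  normalized : ∀ u : ℝ,
    ∫⁻ y, ENNReal.ofReal (h y σ * Real.exp ((y * u - ψ u) / c σ)) ∂base = 1

namespace GLM

variable {d : ℕ}

/-- The conditional density `f_β(y | x)`. -/
def condDensity (G : GLM d) (β : EuclideanSpace ℝ (Fin d)) (y : ℝ)
    (x : EuclideanSpace ℝ (Fin d)) : ℝ :=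
  G.h y G.σ * Real.exp ((y * (∑ j, x j * β j) - G.ψ (∑ j, x j * β j)) / G.c G.σ)

/-- The law of one observation `(y, x)` under the parameter `β`. -/
def law (G : GLM d) (β : EuclideanSpace ℝ (Fin d)) :
    Measure (ℝ × EuclideanSpace ℝ (Fin d)) :=
  (G.base.prod G.design).withDensity fun z => ENNReal.ofReal (G.condDensity β z.1 z.2)

/-- The law of an i.i.d. sample `(y_1, x_1), …, (y_n, x_n)` under the parameter `β`. -/
def sampleLaw (G : GLM d) (n : ℕ) (β : EuclideanSpace ℝ (Fin d)) :
    Measure (Fin n → ℝ × EuclideanSpace ℝ (Fin d)) :=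
  Measure.pi fun _ => G.law β

/-- The second moment matrix `E (x xᵀ)` of the covariates. -/
def secondMoment (G : GLM d) : Matrix (Fin d) (Fin d) ℝ :=
  Matrix.of fun i j => ∫ x, x i * x j ∂G.design

end GLM

/-- `(ε, δ)`-differential privacy of a randomized algorithm `M` on data sets of `n` records: the
output laws on two data sets that differ in a single record satisfy
`P (M X ∈ S) ≤ e^ε P (M X' ∈ S) + δ` for all measurable `S`. -/
def IsDifferentiallyPrivate {n : ℕ} {𝓩 𝓡 : Type*} [MeasurableSpace 𝓩] [MeasurableSpace 𝓡]
    (M : Kernel (Fin n → 𝓩) 𝓡) (ε δ : ℝ) : Prop :=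
  ∀ X X' : Fin n → 𝓩, (∃ i, ∀ j, j ≠ i → X j = X' j) →
    ∀ S : Set 𝓡, MeasurableSet S →
      M X S ≤ ENNReal.ofReal (Real.exp ε) * M X' S + ENNReal.ofReal δ

namespace GLM

variable {d : ℕ}

/-- The mean squared error `E ‖M(y, X) - β‖₂²` of the randomized estimator `M` under `β`, the
expectation being over the sample and the randomness of `M` (possibly `∞`). -/
def risk (G : GLM d) {n : ℕ}
    (M : Kernel (Fin n → ℝ × EuclideanSpace ℝ (Fin d)) (EuclideanSpace ℝ (Fin d)))
    (β : EuclideanSpace ℝ (Fin d)) : ℝ≥0∞ :=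
  ∫⁻ X, ∫⁻ b, ENNReal.ofReal (‖b - β‖ ^ 2) ∂(M X) ∂(G.sampleLaw n β)

/-- The `(ε, δ)`-private minimax risk over all `β ∈ ℝ^d` with `‖β‖₀ ≤ s`: the infimum over the
`(ε, δ)`-differentially private randomized estimators of the worst mean squared error. -/
def privateMinimaxRisk (G : GLM d) (n s : ℕ) (ε δ : ℝ) : ℝ≥0∞ :=
  ⨅ (M : Kernel (Fin n → ℝ × EuclideanSpace ℝ (Fin d)) (EuclideanSpace ℝ (Fin d)))
    (_ : IsMarkovKernel M) (_ : IsDifferentiallyPrivate M ε δ),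
    ⨆ (β : EuclideanSpace ℝ (Fin d)) (_ : hammingNorm (fun j => β j) ≤ s), G.risk M β

end GLM

end

/-!
The supremum runs over all sparse `β`, however large, and this makes privacy far more expensive than
the rate suggests. Restrict `β` to the multiples of one coordinate vector. Take locations whose
binary digits have hugely different place values, and let record `i` follow the location truncated
below its own scale `f i`. Laws of data sets with bounded parameter differences have a bounded
`χ²` divergence, so an estimator of finite worst-case risk gets the digits above all scales right;
but it guesses the digit at the smallest scale, which no record carries, with probability at most
one half. By telescoping, the probabilities of being right down to the scale `f (i + 1)` but not
down to `f i` add up to nearly one half. As `f i` and `f (i + 1)` run through consecutive terms of a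
long sequence these events are disjoint while only two records change, so by privacy a Ramsey-type
choice of the scales makes each of their probabilities at most about `(1 + e ^ ε) δ`. Hence the
private risk is infinite as soon as `n (1 + e ^ ε) δ < 1 / 2`.

Since `δ = O(n ^ (-1 - γ₂))`, only boundedly many `n` remain. For these the right-hand side is at
most a constant times `c(σ)`, and comparing two parameters at distance `√c(σ)` is enough.
-/

/-- The iterated product of `m` copies of `U`, living on sequences whose first `m` entries are
random: `f 0` is chosen first, so `∀ᶠ f in seqUltrafilter U m, P f` says that `P f` holds for
`U`-most `f 0`, for `U`-most `f 1`, …, for `U`-most `f (m - 1)`; the remaining entries are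
`default`. It serves to choose the scales of the records one after the other. -/
noncomputable def seqUltrafilter {α : Type*} [Inhabited α] (U : Ultrafilter α) :
    ℕ → Ultrafilter (ℕ → α)
  | 0 => pure default
  | m + 1 => (seqUltrafilter U m).bind fun f => U.map (Function.update f m)

section seqUltrafilter

open Filter Function

variable {α : Type*} [Inhabited α] {U : Ultrafilter α}

theorem eventually_seqUltrafilter_succ {m : ℕ} {P : (ℕ → α) → Prop} :
    (∀ᶠ f in (seqUltrafilter U (m + 1) : Filter (ℕ → α)), P f) ↔
      ∀ᶠ f in (seqUltrafilter U m : Filter (ℕ → α)), ∀ᶠ k in (U : Filter α), P (update f m k) :=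
  Iff.rfl

theorem eventually_strictMonoOn_seqUltrafilter [Preorder α] [NoMaxOrder α]
    (hU : (U : Filter α) ≤ atTop) (m : ℕ) :
    ∀ᶠ f in (seqUltrafilter U m : Filter (ℕ → α)), StrictMonoOn f (Set.Iio m) := by
  induction m with
  | zero => exact Eventually.of_forall fun f i hi => absurd hi (Nat.not_lt_zero i)
  | succ m ih =>
    refine eventually_seqUltrafilter_succ.2 (ih.mono fun f hf => ?_)
    have hgt : ∀ᶠ k in (U : Filter α), ∀ i ∈ Finset.range m, f i < k :=
      (eventually_all_finset _).2 fun i _ => hU (eventually_gt_atTop (f i))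
    refine hgt.mono fun k hk i hi j hj hij => ?_
    have him : i < m := hij.trans_le (Nat.lt_succ_iff.1 hj)
    rw [update_of_ne him.ne]
    rcases (Nat.lt_succ_iff.1 hj).lt_or_eq with hjm | rfl
    · rw [update_of_ne hjm.ne]
      exact hf him hjm hij
    · rw [update_self]
      exact hk i (Finset.mem_range.2 him)

theorem exists_consecutive_update_of_eventually [Preorder α] [NoMaxOrder α]
    (hU : (U : Filter α) ≤ atTop) {a b : ℕ} {P : (ℕ → α) → Prop}
    (h : ∀ᶠ f in (seqUltrafilter U (a + 2 + b) : Filter (ℕ → α)), P f) (N : ℕ) :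
    ∃ (f : ℕ → α) (y : ℕ → α), StrictMono y ∧
      ∀ j < N, P (update (update f a (y j)) (a + 1) (y (j + 1))) := by
  induction b generalizing P with
  | zero =>
    obtain ⟨f, hf⟩ := (eventually_seqUltrafilter_succ.1 (eventually_seqUltrafilter_succ.1 h)).exists
    set R : α → α → Prop := fun x x' => P (update (update f a x) (a + 1) x')
    have extend : ∀ s : Finset α, (∀ x ∈ s, ∀ᶠ x' in (U : Filter α), R x x') →
        ∃ x', (∀ᶠ x'' in (U : Filter α), R x' x'') ∧ ∀ x ∈ s, R x x' ∧ x < x' := fun s hs =>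
      (hf.and <| (eventually_all_finset s).2 fun x hx =>
        (hs x hx).and (hU (eventually_gt_atTop x))).exists
    obtain ⟨y, -, hy⟩ := exists_seq_of_forall_finset_exists _ _ extend
    exact ⟨f, y, fun i j hij => (hy i j hij).2, fun j _ => (hy j (j + 1) j.lt_succ_self).1⟩
  | succ b ih =>
    obtain ⟨f, y, hy, hP⟩ := ih (eventually_seqUltrafilter_succ.1 h)
    obtain ⟨k, hk⟩ := ((eventually_all_finset (Finset.range N)).2 fun j hj =>
      hP j (Finset.mem_range.1 hj)).exists
    refine ⟨update f (a + 2 + b) k, y, hy, fun j hj => ?_⟩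
    rw [update_comm (by omega : a + 2 + b ≠ a), update_comm (by omega : a + 2 + b ≠ a + 1)]
    exact hk j (Finset.mem_range.2 hj)

theorem exists_strictMonoOn_forall_of_exists_consecutive {n : ℕ} {P : ℕ → (ℕ → ℕ) → Prop}
    (h : ∀ i < n, ∃ N : ℕ, ∀ f y : ℕ → ℕ, StrictMono y →
      ∃ j < N, P i (update (update f i (y j)) (i + 1) (y (j + 1)))) :
    ∃ f : ℕ → ℕ, StrictMonoOn f (Set.Iio (n + 2)) ∧ ∀ i < n, P i f := by
  have hmost : ∀ i < n,
      ∀ᶠ f in (seqUltrafilter (hyperfilter ℕ) (n + 2) : Filter (ℕ → ℕ)), P i f := fun i hi => by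
    by_contra hP
    obtain ⟨N, hN⟩ := h i hi
    rw [← Ultrafilter.eventually_not, show n + 2 = i + 2 + (n - i) by omega] at hP
    obtain ⟨f, y, hy, hnot⟩ :=
      exists_consecutive_update_of_eventually Nat.hyperfilter_le_atTop hP N
    obtain ⟨j, hj, hPj⟩ := hN f y hy
    exact hnot j hj hPj
  obtain ⟨f, hf, hPf⟩ := ((eventually_strictMonoOn_seqUltrafilter Nat.hyperfilter_le_atTop _).and
    ((eventually_all_finset (Finset.range n)).2 fun i hi =>
      hmost i (Finset.mem_range.1 hi))).exists
  exact ⟨f, hf, fun i hi => hPf i (Finset.mem_range.2 hi)⟩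

end seqUltrafilter

theorem exists_scales (r : ℝ → ℝ) :
    ∃ R w : ℕ → ℝ, (∀ k, 0 ≤ w k) ∧ (∀ k, 2 * R k < w k) ∧ (∀ k, R k + w k ≤ R (k + 1)) ∧
      ∀ k, r (∑ j ∈ Finset.range k, w j) ≤ R k := by
  set ρ : ℝ → ℝ := fun x => max (r x) (2 * x)
  let D : ℕ → ℝ := fun k => (fun x => x + (2 * ρ x + 1))^[k] 0
  have hD : ∀ k, D (k + 1) = D k + (2 * ρ (D k) + 1) := fun k =>
    Function.iterate_succ_apply' _ k _
  have hρ : ∀ k, 2 * D k ≤ ρ (D k) := fun k => le_max_right _ _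
  have hD0 : ∀ k, 0 ≤ D k := fun k => by
    induction k with
    | zero => exact le_rfl
    | succ k ih => linarith [hD k, hρ k]
  refine ⟨fun k => ρ (D k), fun k => D (k + 1) - D k, fun k => ?_, fun k => ?_, fun k => ?_,
    fun k => ?_⟩
  · linarith [hD k, hρ k, hD0 k]
  · linarith [hD k]
  · change ρ (D k) + (D (k + 1) - D k) ≤ ρ (D (k + 1))
    linarith [hD k, hρ k, hρ (k + 1), hD0 k]
  · rw [Finset.sum_range_sub]
    change r (D k - 0) ≤ _
    rw [sub_zero]
    exact le_max_left _ _

/-- The location with binary digits `1` at the places in `a` and place values `w`, all places below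
`k` being dropped. -/
noncomputable def digitSum (w : ℕ → ℝ) (a : Finset ℕ) (k : ℕ) : ℝ := ∑ j ∈ a with k ≤ j, w j

/-- The set of estimates that get all digits of `a` at the places `k` and above right, when the
scale `R k` is small compared with the place value `w k`. -/
noncomputable def digitBall (w R : ℕ → ℝ) (a : Finset ℕ) (k : ℕ) : Set ℝ :=
  Metric.closedBall (digitSum w a k) (R k)

/-- A data set of `n` parameters approximating the location with digits `a`: the record `i` only
knows the digits at places above `f i`. -/
noncomputable def digitRecords (n : ℕ) (w : ℕ → ℝ) (f : ℕ → ℕ) (a : Finset ℕ) : Fin n → ℝ :=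
  fun i => digitSum w a (f i + 1)

section digits

variable {w R : ℕ → ℝ} {a : Finset ℕ}

theorem digitSum_insert_of_lt {k K : ℕ} (h : K < k) :
    digitSum w (insert K a) k = digitSum w a k := by
  rw [digitSum, digitSum, Finset.filter_insert, if_neg h.not_ge]

theorem digitSum_insert_self {K : ℕ} (h : K ∉ a) :
    digitSum w (insert K a) K = w K + digitSum w a K := by
  rw [digitSum, digitSum, Finset.filter_insert, if_pos le_rfl, Finset.sum_insert (by simp [h])]

theorem abs_digitSum_sub_le (hw : ∀ k, 0 ≤ w k) {k K : ℕ} (h : k ≤ K) :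
    |digitSum w a k - digitSum w a K| ≤ ∑ j ∈ Finset.Ico k K, w j := by
  have hsplit : digitSum w a k = digitSum w a K + ∑ j ∈ a with k ≤ j ∧ ¬K ≤ j, w j := by
    rw [digitSum, ← Finset.sum_filter_add_sum_filter_not _ (K ≤ ·), Finset.filter_filter,
      Finset.filter_filter, digitSum]
    simp only [and_iff_right_of_imp h.trans]
  rw [hsplit, add_sub_cancel_left, abs_of_nonneg (Finset.sum_nonneg fun j _ => hw j)]
  refine Finset.sum_le_sum_of_subset_of_nonneg (fun j hj => ?_) fun j _ _ => hw j
  simpa using (Finset.mem_filter.1 hj).2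

theorem measurableSet_digitBall (k : ℕ) : MeasurableSet (digitBall w R a k) :=
  Metric.isClosed_closedBall.measurableSet

theorem monotone_digitBall (hw : ∀ k, 0 ≤ w k) (hR : ∀ k, R k + w k ≤ R (k + 1)) :
    Monotone (digitBall w R a) := by
  refine monotone_nat_of_le_succ fun k => Metric.closedBall_subset_closedBall' ?_
  have hdist : dist (digitSum w a k) (digitSum w a (k + 1)) ≤ w k := by
    simpa [Real.dist_eq] using abs_digitSum_sub_le (a := a) hw k.le_succ
  linarith [hR k]

theorem disjoint_digitBall_insert {K : ℕ} (ha : K ∉ a) (hR : 2 * R K < w K) :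
    Disjoint (digitBall w R a K) (digitBall w R (insert K a) K) := by
  refine Metric.closedBall_disjoint_closedBall ?_
  rw [digitSum_insert_self ha, Real.dist_eq, abs_sub_comm, add_sub_cancel_right]
  linarith [le_abs_self (w K)]

end digits

section LocationEstimation

open Function
open scoped BigOperators

theorem expect_measureReal_digitBall_le_half {n N K : ℕ} {w R : ℕ → ℝ} (hR : 2 * R K < w K)
    (Q : (Fin n → ℝ) → Measure ℝ) [∀ t, IsProbabilityMeasure (Q t)] {f : ℕ → ℕ}
    (hf : ∀ i < n, K ≤ f i) (hKN : K < N) :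
    𝔼 a ∈ (Finset.range N).powerset, (Q (digitRecords n w f a)).real (digitBall w R a K) ≤
      1 / 2 := by
  set s := (Finset.range N).erase K
  have hKs : K ∉ s := Finset.notMem_erase K _
  have hs : Finset.range N = insert K s := (Finset.insert_erase (Finset.mem_range.2 hKN)).symm
  have hcard : ((insert K s).powerset.card : ℝ) = 2 * s.powerset.card := by
    rw [Finset.card_powerset, Finset.card_powerset, Finset.card_insert_of_notMem hKs]
    push_cast
    ring
  have hpair : ∀ a ∈ s.powerset, (Q (digitRecords n w f a)).real (digitBall w R a K) +
      (Q (digitRecords n w f (insert K a))).real (digitBall w R (insert K a) K) ≤ 1 :=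
    fun a ha => by
      have hKa : K ∉ a := fun h => hKs (Finset.mem_powerset.1 ha h)
      have hrec : digitRecords n w f (insert K a) = digitRecords n w f a :=
        funext fun i => digitSum_insert_of_lt (Nat.lt_succ_of_le (hf i i.2))
      rw [hrec, ← measureReal_union (disjoint_digitBall_insert hKa hR) (measurableSet_digitBall K)]
      exact measureReal_le_one
  rw [hs, Finset.expect_eq_sum_div_card,
    div_le_iff₀ (Nat.cast_pos.2 (Finset.powerset_nonempty _).card_pos),
    Finset.sum_powerset_insert hKs, ← Finset.sum_add_distrib, hcard]
  refine (Finset.sum_le_card_nsmul _ _ 1 hpair).trans_eq ?_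
  rw [nsmul_eq_mul]
  ring

theorem sum_measureReal_sdiff_succ {Ω : Type*} [MeasurableSpace Ω] (μ : Measure Ω)
    [IsFiniteMeasure μ] {F : ℕ → Set Ω} {m : ℕ} (hF : ∀ k, MeasurableSet (F k))
    (hsub : ∀ i < m, F i ⊆ F (i + 1)) :
    ∑ i ∈ Finset.range m, μ.real (F (i + 1) \ F i) = μ.real (F m) - μ.real (F 0) := by
  rw [← Finset.sum_range_sub (fun i => μ.real (F i))]
  exact Finset.sum_congr rfl fun i hi => measureReal_sdiff (hsub i (Finset.mem_range.1 hi)) (hF i)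

theorem sum_measureReal_sdiff_succ_le {Ω : Type*} [MeasurableSpace Ω] (μ : Measure Ω)
    [IsProbabilityMeasure μ] (ν : ℕ → Measure Ω) {A B : ℝ} (hA : 0 ≤ A)
    (hν : ∀ j S, MeasurableSet S → (ν j).real S ≤ A * μ.real S + B) {F : ℕ → Set Ω}
    (hF : ∀ k, MeasurableSet (F k)) (hmono : Monotone F) (m : ℕ) :
    ∑ j ∈ Finset.range m, (ν j).real (F (j + 1) \ F j) ≤ A + m * B :=
  calc ∑ j ∈ Finset.range m, (ν j).real (F (j + 1) \ F j)
      ≤ ∑ j ∈ Finset.range m, (A * μ.real (F (j + 1) \ F j) + B) :=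
        Finset.sum_le_sum fun j _ => hν j _ ((hF _).diff (hF _))
    _ = A * (μ.real (F m) - μ.real (F 0)) + m * B := by
        rw [Finset.sum_add_distrib, ← Finset.mul_sum,
          sum_measureReal_sdiff_succ μ hF fun i _ => hmono i.le_succ, Finset.sum_const,
          Finset.card_range, nsmul_eq_mul]
    _ ≤ A * 1 + m * B := by
        gcongr
        linarith [measureReal_le_one (μ := μ) (s := F m), measureReal_nonneg (μ := μ) (s := F 0)]
    _ = A + m * B := by rw [mul_one]

/-- Privacy of a family of laws indexed by data sets of `n` records, with the multiplicative
constant `e` in place of `e^ε` and without measurability in the data set. -/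
def IsPrivateFamily {n : ℕ} {𝓩 Ω : Type*} [MeasurableSpace Ω] (Q : (Fin n → 𝓩) → Measure Ω)
    (e δ : ℝ) : Prop :=
  ∀ t t' i, (∀ j, j ≠ i → t j = t' j) → ∀ S, MeasurableSet S →
    (Q t).real S ≤ e * (Q t').real S + δ

theorem IsPrivateFamily.le_of_eq_off_consecutive {n : ℕ} {𝓩 Ω : Type*} [MeasurableSpace Ω]
    {Q : (Fin n → 𝓩) → Measure Ω} {e δ : ℝ} (hQ : IsPrivateFamily Q e δ) (he : 0 ≤ e) (i : Fin n)
    {t t' : Fin n → 𝓩} (h : ∀ j : Fin n, j ≠ i → (j : ℕ) ≠ i + 1 → t j = t' j) {S : Set Ω}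
    (hS : MeasurableSet S) :
    (Q t).real S ≤ e ^ 2 * (Q t').real S + (1 + e) * δ := by
  have hfst : (Q t).real S ≤ e * (Q (update t i (t' i))).real S + δ :=
    hQ _ _ i (fun j hj => (update_of_ne hj _ _).symm) S hS
  obtain ⟨k, hk⟩ : ∃ k : Fin n, ∀ j, j ≠ k → update t i (t' i) j = t' j := by
    have hoff : ∀ j : Fin n, (j : ℕ) ≠ i + 1 → update t i (t' i) j = t' j := fun j hj => by
      rcases eq_or_ne j i with rfl | hji
      · exact update_self _ _ _
      · rw [update_of_ne hji, h j hji hj]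
    rcases lt_or_ge ((i : ℕ) + 1) n with hi | hi
    · exact ⟨⟨i + 1, hi⟩, fun j hj => hoff j fun hji => hj (Fin.ext hji)⟩
    · exact ⟨i, fun j _ => hoff j (by omega)⟩
  have hsnd := hQ _ _ k hk S hS
  calc (Q t).real S ≤ e * (e * (Q t').real S + δ) + δ := hfst.trans (by gcongr)
    _ = e ^ 2 * (Q t').real S + (1 + e) * δ := by ring

theorem IsPrivateFamily.map_comp {n : ℕ} {𝓩 𝓩' Ω Ω' : Type*} [MeasurableSpace Ω]
    [MeasurableSpace Ω'] {Q : (Fin n → 𝓩) → Measure Ω} {e δ : ℝ} (hQ : IsPrivateFamily Q e δ)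
    (φ : 𝓩' → 𝓩) {g : Ω → Ω'} (hg : Measurable g) :
    IsPrivateFamily (fun t => (Q fun i => φ (t i)).map g) e δ := fun t t' i h S hS => by
  rw [map_measureReal_apply hg hS, map_measureReal_apply hg hS]
  exact hQ _ _ i (fun j hj => congrArg φ (h j hj)) _ (hg hS)

variable {n : ℕ} {w R : ℕ → ℝ} {Q : (Fin n → ℝ) → Measure ℝ} [∀ t, IsProbabilityMeasure (Q t)]

/- Under one fixed data set, the events that the digits at `y (j + 1)` and above, but not those at
`y j` and above, are right are disjoint for different `j`; privacy transfers this to the data sets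
where the records `i` and `i + 1` have moved, at a cost that does not grow with `m`. -/
theorem IsPrivateFamily.exists_expect_sdiff_le {e δ η : ℝ} (hQ : IsPrivateFamily Q e δ)
    (he : 0 ≤ e) (hw : ∀ k, 0 ≤ w k) (hR : ∀ k, R k + w k ≤ R (k + 1)) (hη : (1 + e) * δ < η)
    (i : Fin n) :
    ∃ m : ℕ, ∀ (f y : ℕ → ℕ) (s : Finset (Finset ℕ)), StrictMono y → s.Nonempty → ∃ j < m,
      𝔼 a ∈ s, (Q (digitRecords n w (update (update f i (y j)) (i + 1) (y (j + 1))) a)).real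
        (digitBall w R a (y (j + 1)) \ digitBall w R a (y j)) ≤ η := by
  obtain ⟨m, hm⟩ := exists_nat_gt (e ^ 2 / (η - (1 + e) * δ))
  have hm0 : 0 < m := by
    have : 0 ≤ e ^ 2 / (η - (1 + e) * δ) := div_nonneg (sq_nonneg e) (sub_pos.2 hη).le
    exact_mod_cast this.trans_lt hm
  rw [div_lt_iff₀ (sub_pos.2 hη)] at hm
  refine ⟨m, fun f y s hy hs => ?_⟩
  let ν : Finset ℕ → ℕ → Measure ℝ := fun a j =>
    Q (digitRecords n w (update (update f i (y j)) (i + 1) (y (j + 1))) a)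
  have hνQ : ∀ a j S, MeasurableSet S →
      (ν a j).real S ≤ e ^ 2 * (Q (digitRecords n w f a)).real S + (1 + e) * δ :=
    fun a j S hS => hQ.le_of_eq_off_consecutive he i (fun k hki hki' => by
      rw [digitRecords, digitRecords, update_of_ne hki',
        update_of_ne fun h => hki (Fin.ext h)]) hS
  have hsum : ∀ a, ∑ j ∈ Finset.range m,
      (ν a j).real (digitBall w R a (y (j + 1)) \ digitBall w R a (y j)) ≤ m * η := fun a =>
    (sum_measureReal_sdiff_succ_le _ (ν a) (sq_nonneg e) (hνQ a)
      (fun k => measurableSet_digitBall (y k))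
      ((monotone_digitBall hw hR).comp hy.monotone) m).trans (by linarith)
  have hexpect : ∑ j ∈ Finset.range m, 𝔼 a ∈ s,
      (ν a j).real (digitBall w R a (y (j + 1)) \ digitBall w R a (y j)) ≤
        ∑ _j ∈ Finset.range m, η := by
    rw [← Finset.expect_sum_comm, Finset.sum_const, Finset.card_range, nsmul_eq_mul]
    exact Finset.expect_le hs fun a _ => hsum a
  obtain ⟨j, hj, hle⟩ := Finset.exists_le_of_sum_le (Finset.nonempty_range_iff.2 hm0.ne') hexpect
  exact ⟨j, Finset.mem_range.1 hj, hle⟩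

theorem expect_measureReal_digitBall_sub_half_le (hw : ∀ k, 0 ≤ w k) (hRw : ∀ k, 2 * R k < w k)
    (hR : ∀ k, R k + w k ≤ R (k + 1)) {f : ℕ → ℕ} (hf : StrictMonoOn f (Set.Iio (n + 2))) :
    𝔼 a ∈ (Finset.range (f (n + 1))).powerset,
        (Q (digitRecords n w f a)).real (digitBall w R a (f n)) - 1 / 2 ≤
      ∑ i ∈ Finset.range n, 𝔼 a ∈ (Finset.range (f (n + 1))).powerset,
        (Q (digitRecords n w f a)).real (digitBall w R a (f (i + 1)) \ digitBall w R a (f i)) := by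
  have hhalf := expect_measureReal_digitBall_le_half (hRw (f 0)) Q (f := f) (N := f (n + 1))
    (fun i hi => hf.monotoneOn (Set.mem_Iio.2 (by omega)) (Set.mem_Iio.2 (by omega)) i.zero_le)
    (hf (Set.mem_Iio.2 (by omega)) (Set.mem_Iio.2 (by omega)) n.succ_pos)
  have htelescope : ∀ a, ∑ i ∈ Finset.range n,
      (Q (digitRecords n w f a)).real (digitBall w R a (f (i + 1)) \ digitBall w R a (f i)) =
        (Q (digitRecords n w f a)).real (digitBall w R a (f n)) -
          (Q (digitRecords n w f a)).real (digitBall w R a (f 0)) := fun a =>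
    sum_measureReal_sdiff_succ _ (fun k => measurableSet_digitBall (f k)) fun i hi =>
      monotone_digitBall hw hR (hf.monotoneOn (Set.mem_Iio.2 (by omega))
        (Set.mem_Iio.2 (by omega)) i.le_succ)
  rw [← Finset.expect_sum_comm]
  simp_rw [htelescope]
  rw [Finset.expect_sub_distrib]
  linarith

theorem one_sub_le_measureReal_digitBall {α : ℝ} {r : ℝ → ℝ}
    (hr : ∀ D t b, (∀ i, |t i - b| ≤ D) → (Q t).real {x | r D < |x - b|} ≤ α)
    (hw : ∀ k, 0 ≤ w k) (hrR : ∀ k, r (∑ j ∈ Finset.range k, w j) ≤ R k) {f : ℕ → ℕ} {k : ℕ}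
    (hf : ∀ i < n, f i < k) (a : Finset ℕ) :
    1 - α ≤ (Q (digitRecords n w f a)).real (digitBall w R a k) := by
  set D := ∑ j ∈ Finset.range k, w j
  have hclose : ∀ i, |digitRecords n w f a i - digitSum w a k| ≤ D := fun i =>
    (abs_digitSum_sub_le hw (Nat.succ_le_of_lt (hf i i.2))).trans
      (Finset.sum_le_sum_of_subset_of_nonneg
        (fun j hj => Finset.mem_range.2 (Finset.mem_Ico.1 hj).2) fun j _ _ => hw j)
  have hmiss : (digitBall w R a k)ᶜ ⊆ {x | r D < |x - digitSum w a k|} := fun x hx =>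
    (hrR k).trans_lt (by simpa [digitBall, Real.dist_eq] using hx)
  have hle := (measureReal_mono hmiss).trans (hr D _ _ hclose)
  rw [probReal_compl_eq_one_sub (measurableSet_digitBall k)] at hle
  linarith

theorem IsPrivateFamily.not_accurate {e δ α : ℝ} (hQ : IsPrivateFamily Q e δ) (he : 0 ≤ e)
    (hδ : n * ((1 + e) * δ) + α < 1 / 2) :
    ¬∀ D, ∃ r, ∀ t b, (∀ i, |t i - b| ≤ D) → (Q t).real {x | r < |x - b|} ≤ α := by
  intro hacc
  choose r hr using hacc
  obtain ⟨R, w, hw, hRw, hR, hrR⟩ := exists_scales r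
  set g := 1 / 2 - α - n * ((1 + e) * δ)
  have hg : 0 < g := by simp only [g]; linarith
  set η := (1 + e) * δ + g / (n + 1)
  have hη : (1 + e) * δ < η := lt_add_of_pos_right _ (by positivity)
  obtain ⟨f, hf, hjump⟩ := exists_strictMonoOn_forall_of_exists_consecutive (n := n)
    (P := fun i f => 𝔼 a ∈ (Finset.range (f (n + 1))).powerset, (Q (digitRecords n w f a)).real
      (digitBall w R a (f (i + 1)) \ digitBall w R a (f i)) ≤ η) fun i hi => by
    obtain ⟨m, hm⟩ := hQ.exists_expect_sdiff_le he hw hR hη ⟨i, hi⟩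
    refine ⟨m, fun f y hy => ?_⟩
    obtain ⟨j, hj, hle⟩ :=
      hm f y (Finset.range (f (n + 1))).powerset hy (Finset.powerset_nonempty _)
    refine ⟨j, hj, ?_⟩
    simpa [update_of_ne (by omega : n + 1 ≠ i), update_of_ne (by omega : n + 1 ≠ i + 1)] using hle
  have hacc : 1 - α ≤ 𝔼 a ∈ (Finset.range (f (n + 1))).powerset,
      (Q (digitRecords n w f a)).real (digitBall w R a (f n)) :=
    Finset.le_expect (Finset.powerset_nonempty _) fun a _ =>
      one_sub_le_measureReal_digitBall hr hw hrR (fun i hi =>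
        hf (Set.mem_Iio.2 (by omega)) (Set.mem_Iio.2 (by omega)) hi) a
  have hsum := (expect_measureReal_digitBall_sub_half_le (Q := Q) hw hRw hR hf).trans
    (Finset.sum_le_sum fun i hi => hjump i (Finset.mem_range.1 hi))
  rw [Finset.sum_const, Finset.card_range, nsmul_eq_mul] at hsum
  have hng : n * (g / (n + 1)) < g := by
    rw [mul_div_assoc', div_lt_iff₀ (by positivity)]
    linarith
  have : n * η = n * ((1 + e) * δ) + n * (g / (n + 1)) := mul_add _ _ _
  simp only [g] at this hng hsum
  linarith

end LocationEstimation

theorem add_sub_two_mul_le_of_deriv_deriv_le {ψ : ℝ → ℝ} (hψ : ContDiff ℝ 2 ψ) {K : ℝ}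
    (hK : ∀ u, deriv (deriv ψ) u ≤ K) (v h : ℝ) :
    ψ (v + h) + ψ (v - h) - 2 * ψ v ≤ K * h ^ 2 := by
  have hfst : ∀ u, HasDerivAt (fun u => K / 2 * u ^ 2 - ψ u) (K * u - deriv ψ u) u := fun u =>
    (((hasDerivAt_pow 2 u).const_mul (K / 2)).sub
      (hψ.differentiable two_ne_zero u).hasDerivAt).congr_deriv (by push_cast; ring)
  have hsnd : ∀ u, HasDerivAt (fun u => K * u - deriv ψ u) (K - deriv (deriv ψ) u) u := fun u =>
    (((hasDerivAt_id' u).const_mul K).sub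
      (hψ.differentiable_deriv_two u).hasDerivAt).congr_deriv (by rw [mul_one])
  have hconvex : ConvexOn ℝ Set.univ fun u => K / 2 * u ^ 2 - ψ u :=
    convexOn_of_hasDerivWithinAt2_nonneg convex_univ
      (fun u _ => (hfst u).continuousAt.continuousWithinAt) (fun u _ => (hfst u).hasDerivWithinAt)
      (fun u _ => (hsnd u).hasDerivWithinAt) fun u _ => sub_nonneg.2 (hK u)
  have hmid := hconvex.2 (Set.mem_univ (v + h)) (Set.mem_univ (v - h))
    (by norm_num : (0 : ℝ) ≤ 1 / 2) (by norm_num : (0 : ℝ) ≤ 1 / 2) (by norm_num)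
  simp only [smul_eq_mul] at hmid
  rw [show 1 / 2 * (v + h) + 1 / 2 * (v - h) = v by ring] at hmid
  linarith

section Measure

theorem lintegral_withDensity_le_add_div {Ω : Type*} [MeasurableSpace Ω] {μ : Measure Ω}
    {ρ g : Ω → ℝ≥0∞} (hρ : Measurable ρ) (hg : Measurable g) (hg1 : ∀ ω, g ω ≤ 1) {T : ℝ≥0∞}
    (hT : T ≠ 0) (hT' : T ≠ ⊤) :
    ∫⁻ ω, g ω ∂(μ.withDensity ρ) ≤ T * ∫⁻ ω, g ω ∂μ + (∫⁻ ω, ρ ω ^ 2 ∂μ) / T := by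
  have hpoint : ∀ ω, (ρ * g) ω ≤ T * g ω + ρ ω ^ 2 / T := fun ω => by
    rcases le_total (ρ ω) T with h | h
    · exact le_add_right (mul_le_mul_left h _)
    · refine le_add_left ?_
      rw [ENNReal.le_div_iff_mul_le (Or.inl hT) (Or.inl hT'), sq]
      exact mul_le_mul' (mul_le_of_le_one_right' (hg1 ω)) h
  rw [lintegral_withDensity_eq_lintegral_mul _ hρ hg]
  refine (lintegral_mono hpoint).trans_eq ?_
  simp_rw [div_eq_mul_inv]
  rw [lintegral_add_left (hg.const_mul T), lintegral_const_mul _ hg,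
    lintegral_mul_const _ (hρ.pow_const 2)]

variable {ι : Type*} [Fintype ι] {Ω : ι → Type*} [∀ i, MeasurableSpace (Ω i)]

theorem lintegral_pi_prod (μ : ∀ i, Measure (Ω i)) [∀ i, IsProbabilityMeasure (μ i)]
    {f : ∀ i, Ω i → ℝ≥0∞} (hf : ∀ i, Measurable (f i)) :
    ∫⁻ X, ∏ i, f i (X i) ∂(Measure.pi μ) = ∏ i, ∫⁻ x, f i x ∂(μ i) := by
  refine (lintegral_prod_eq_prod_lintegral_of_indepFun Finset.univ
    (fun i (X : ∀ i, Ω i) => f i (X i)) (iIndepFun_pi fun i => (hf i).aemeasurable)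
    fun i => (hf i).comp (measurable_pi_apply i)).trans ?_
  exact Finset.prod_congr rfl fun i _ => (measurePreserving_eval μ i).lintegral_comp (hf i)

theorem pi_withDensity_prod (μ : ∀ i, Measure (Ω i)) [∀ i, IsProbabilityMeasure (μ i)]
    {ρ : ∀ i, Ω i → ℝ≥0∞} (hρ : ∀ i, Measurable (ρ i))
    [∀ i, SigmaFinite ((μ i).withDensity (ρ i))] :
    Measure.pi (fun i => (μ i).withDensity (ρ i)) =
      (Measure.pi μ).withDensity fun X => ∏ i, ρ i (X i) := by
  refine Measure.pi_eq fun s hs => ?_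
  have hindicator : (Set.univ.pi s).indicator (fun X => ∏ i, ρ i (X i)) =
      fun X => ∏ i, (s i).indicator (ρ i) (X i) := by
    funext X
    by_cases hX : X ∈ Set.univ.pi s
    · rw [Set.indicator_of_mem hX]
      exact Finset.prod_congr rfl fun i _ => (Set.indicator_of_mem (hX i (Set.mem_univ i)) _).symm
    · obtain ⟨i, hi⟩ : ∃ i, X i ∉ s i := by simpa using hX
      rw [Set.indicator_of_notMem hX,
        Finset.prod_eq_zero (Finset.mem_univ i) (Set.indicator_of_notMem hi _)]
  rw [withDensity_apply _ (MeasurableSet.univ_pi hs),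
    ← lintegral_indicator (MeasurableSet.univ_pi hs), hindicator,
    lintegral_pi_prod μ fun i => (hρ i).indicator (hs i)]
  exact Finset.prod_congr rfl fun i _ => by
    rw [lintegral_indicator (hs i), withDensity_apply _ (hs i)]

theorem map_update_pi_prod [DecidableEq ι] (μ μ' : ∀ i, Measure (Ω i)) [∀ i, SigmaFinite (μ i)]
    [∀ i, SigmaFinite (μ' i)] (i : ι) [IsProbabilityMeasure (μ i)] (h : ∀ j, j ≠ i → μ j = μ' j) :
    ((Measure.pi μ).prod (μ' i)).map (fun p => Function.update p.1 i p.2) = Measure.pi μ' := by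
  refine (Measure.pi_eq fun s hs => ?_).symm
  have hpre : (fun p : (∀ i, Ω i) × Ω i => Function.update p.1 i p.2) ⁻¹' Set.univ.pi s =
      Set.univ.pi (Function.update s i Set.univ) ×ˢ s i := by
    ext ⟨X, x⟩
    simp only [Set.mem_preimage, Set.mem_univ_pi, Set.mem_prod]
    rw [Function.forall_update_iff (p := fun j y => y ∈ s j),
      Function.forall_update_iff (p := fun j t => X j ∈ t)]
    simp only [Set.mem_univ, true_and, and_comm]
  rw [Measure.map_apply measurable_update' (MeasurableSet.univ_pi hs), hpre, Measure.prod_prod,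
    Measure.pi_pi, ← Finset.mul_prod_erase _ _ (Finset.mem_univ i),
    ← Finset.mul_prod_erase _ (fun j => μ' j (s j)) (Finset.mem_univ i), Function.update_self,
    measure_univ, one_mul, mul_comm]
  congr 1
  refine Finset.prod_congr rfl fun j hj => ?_
  have hji := Finset.ne_of_mem_erase hj
  rw [Function.update_of_ne hji, h j hji]

end Measure

theorem IsDifferentiallyPrivate.bind_pi_le {n : ℕ} {𝓩 𝓡 : Type*} [MeasurableSpace 𝓩]
    [MeasurableSpace 𝓡] {M : Kernel (Fin n → 𝓩) 𝓡} {ε δ : ℝ} (hM : IsDifferentiallyPrivate M ε δ)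
    (μ μ' : Fin n → Measure 𝓩) [∀ i, IsProbabilityMeasure (μ i)]
    [∀ i, IsProbabilityMeasure (μ' i)] (i : Fin n) (h : ∀ j, j ≠ i → μ j = μ' j)
    {S : Set 𝓡} (hS : MeasurableSet S) :
    (Measure.pi μ).bind M S ≤
      ENNReal.ofReal (Real.exp ε) * (Measure.pi μ').bind M S + ENNReal.ofReal δ := by
  have hMS : Measurable fun X => M X S := M.measurable_coe hS
  have hMS' : Measurable fun p : (Fin n → 𝓩) × 𝓩 => M (Function.update p.1 i p.2) S :=
    hMS.comp measurable_update'
  rw [Measure.bind_apply hS M.measurable.aemeasurable,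
    Measure.bind_apply hS M.measurable.aemeasurable, ← map_update_pi_prod μ μ' i h,
    lintegral_map hMS measurable_update']
  calc ∫⁻ X, M X S ∂(Measure.pi μ) = ∫⁻ p, M p.1 S ∂((Measure.pi μ).prod (μ' i)) :=
        (measurePreserving_fst.lintegral_comp hMS).symm
    _ ≤ ∫⁻ p, (ENNReal.ofReal (Real.exp ε) * M (Function.update p.1 i p.2) S +
          ENNReal.ofReal δ) ∂((Measure.pi μ).prod (μ' i)) :=
        lintegral_mono fun p =>
          hM _ _ ⟨i, fun j hj => (Function.update_of_ne hj _ _).symm⟩ S hS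
    _ = ENNReal.ofReal (Real.exp ε) *
          ∫⁻ p, M (Function.update p.1 i p.2) S ∂((Measure.pi μ).prod (μ' i)) +
        ENNReal.ofReal δ := by
        rw [lintegral_add_right _ measurable_const, lintegral_const_mul _ hMS', lintegral_const,
          measure_univ, mul_one]

namespace GLM

open scoped InnerProductSpace NNReal

variable {d : ℕ} (G : GLM d)

theorem condDensity_eq_inner (β : EuclideanSpace ℝ (Fin d)) (y : ℝ)
    (x : EuclideanSpace ℝ (Fin d)) :
    G.condDensity β y x = G.h y G.σ * Real.exp ((y * ⟪x, β⟫_ℝ - G.ψ ⟪x, β⟫_ℝ) / G.c G.σ) := by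
  simp [condDensity, PiLp.inner_apply, mul_comm]

theorem measurable_condDensity (β : EuclideanSpace ℝ (Fin d)) :
    Measurable fun z : ℝ × EuclideanSpace ℝ (Fin d) => G.condDensity β z.1 z.2 := by
  have hψ : Measurable G.ψ := G.ψ_contDiff.continuous.measurable
  have hh := G.h_measurable
  simp_rw [condDensity_eq_inner]
  fun_prop

theorem lintegral_condDensity (β : EuclideanSpace ℝ (Fin d)) :
    ∫⁻ z, ENNReal.ofReal (G.condDensity β z.1 z.2) ∂(G.base.prod G.design) = 1 := by
  have := G.base_sigmaFinite
  have := G.design_isProbabilityMeasure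
  rw [lintegral_prod_symm _ (G.measurable_condDensity β).ennreal_ofReal.aemeasurable]
  simp [condDensity, G.normalized]

instance (β : EuclideanSpace ℝ (Fin d)) : IsProbabilityMeasure (G.law β) :=
  ⟨by rw [law, withDensity_apply _ MeasurableSet.univ, Measure.restrict_univ,
    lintegral_condDensity]⟩

/-- The likelihood ratio `dP_{β'} / dP_β` of one observation. -/
noncomputable def likelihoodRatio (β β' : EuclideanSpace ℝ (Fin d))
    (z : ℝ × EuclideanSpace ℝ (Fin d)) : ℝ :=
  Real.exp ((z.1 * ⟪z.2, β' - β⟫_ℝ - G.ψ ⟪z.2, β'⟫_ℝ + G.ψ ⟪z.2, β⟫_ℝ) / G.c G.σ)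

theorem likelihoodRatio_nonneg (β β' : EuclideanSpace ℝ (Fin d))
    (z : ℝ × EuclideanSpace ℝ (Fin d)) : 0 ≤ G.likelihoodRatio β β' z :=
  Real.exp_nonneg _

theorem measurable_likelihoodRatio (β β' : EuclideanSpace ℝ (Fin d)) :
    Measurable (G.likelihoodRatio β β') := by
  have hψ : Measurable G.ψ := G.ψ_contDiff.continuous.measurable
  unfold likelihoodRatio
  fun_prop

theorem condDensity_mul_likelihoodRatio (β β' : EuclideanSpace ℝ (Fin d))
    (z : ℝ × EuclideanSpace ℝ (Fin d)) :
    G.condDensity β z.1 z.2 * G.likelihoodRatio β β' z = G.condDensity β' z.1 z.2 := by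
  rw [condDensity_eq_inner, condDensity_eq_inner, likelihoodRatio, mul_assoc, ← Real.exp_add,
    inner_sub_right]
  congr 2
  ring

theorem law_eq_withDensity (β β' : EuclideanSpace ℝ (Fin d)) :
    G.law β' = (G.law β).withDensity fun z => ENNReal.ofReal (G.likelihoodRatio β β' z) := by
  rw [law, law, ← withDensity_mul _ (G.measurable_condDensity _).ennreal_ofReal
    (G.measurable_likelihoodRatio β β').ennreal_ofReal]
  congr 1
  funext z
  rw [Pi.mul_apply, ← ENNReal.ofReal_mul' (G.likelihoodRatio_nonneg β β' z),
    condDensity_mul_likelihoodRatio]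

/- Up to the factor `exp (c₂ B² / c(σ))`, the product of the density at `β` with the squared
likelihood ratio is the density at the reflection `2 β' - β` of `β` in `β'`. -/
theorem condDensity_mul_likelihoodRatio_sq_le {c₂ B : ℝ}
    (hψ : ∀ u, |deriv (deriv G.ψ) u| ≤ c₂) {β β' : EuclideanSpace ℝ (Fin d)}
    {z : ℝ × EuclideanSpace ℝ (Fin d)} (hz : |⟪z.2, β' - β⟫_ℝ| ≤ B) :
    G.condDensity β z.1 z.2 * G.likelihoodRatio β β' z ^ 2 ≤
      Real.exp (c₂ * B ^ 2 / G.c G.σ) * G.condDensity (2 • β' - β) z.1 z.2 := by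
  obtain ⟨y, x⟩ := z
  set u := ⟪x, β'⟫_ℝ
  set h := ⟪x, β' - β⟫_ℝ
  have hβ : ⟪x, β⟫_ℝ = u - h := by simp only [u, h, inner_sub_right]; ring
  have hreflect : ⟪x, 2 • β' - β⟫_ℝ = u + h := by
    rw [two_nsmul, add_sub_assoc, inner_add_right]
  have hh : h ^ 2 ≤ B ^ 2 := sq_le_sq' (abs_le.1 hz).1 (abs_le.1 hz).2
  have hψh : G.ψ (u + h) + G.ψ (u - h) - 2 * G.ψ u ≤ c₂ * B ^ 2 :=
    (add_sub_two_mul_le_of_deriv_deriv_le G.ψ_contDiff (fun v => (abs_le.1 (hψ v)).2) u h).trans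
      (mul_le_mul_of_nonneg_left hh ((abs_nonneg _).trans (hψ 0)))
  rw [condDensity_eq_inner, condDensity_eq_inner, likelihoodRatio, hβ, hreflect,
    ← Real.exp_nat_mul, mul_assoc, ← Real.exp_add, mul_left_comm, ← Real.exp_add]
  refine mul_le_mul_of_nonneg_left (Real.exp_le_exp.2 ?_) (G.h_nonneg y)
  rw [← mul_div_assoc, ← add_div, ← add_div]
  refine div_le_div_of_nonneg_right ?_ G.c_pos.le
  push_cast
  linarith

theorem lintegral_likelihoodRatio_sq_le {c₂ B : ℝ} (hψ : ∀ u, |deriv (deriv G.ψ) u| ≤ c₂)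
    {β β' : EuclideanSpace ℝ (Fin d)} (hx : ∀ᵐ x ∂G.design, |⟪x, β' - β⟫_ℝ| ≤ B) :
    ∫⁻ z, ENNReal.ofReal (G.likelihoodRatio β β' z) ^ 2 ∂(G.law β) ≤
      ENNReal.ofReal (Real.exp (c₂ * B ^ 2 / G.c G.σ)) := by
  have := G.base_sigmaFinite
  have := G.design_isProbabilityMeasure
  rw [law, lintegral_withDensity_eq_lintegral_mul _ (G.measurable_condDensity _).ennreal_ofReal
    ((G.measurable_likelihoodRatio β β').ennreal_ofReal.pow_const 2)]
  calc _ ≤ ∫⁻ z, ENNReal.ofReal (Real.exp (c₂ * B ^ 2 / G.c G.σ)) *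
          ENNReal.ofReal (G.condDensity (2 • β' - β) z.1 z.2) ∂(G.base.prod G.design) := by
        refine lintegral_mono_ae ?_
        filter_upwards [Measure.quasiMeasurePreserving_snd.ae hx] with z hz
        rw [Pi.mul_apply, ← ENNReal.ofReal_pow (G.likelihoodRatio_nonneg β β' z),
          ← ENNReal.ofReal_mul' (sq_nonneg _), ← ENNReal.ofReal_mul (Real.exp_nonneg _)]
        exact ENNReal.ofReal_le_ofReal (G.condDensity_mul_likelihoodRatio_sq_le hψ hz)
    _ = ENNReal.ofReal (Real.exp (c₂ * B ^ 2 / G.c G.σ)) := by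
        rw [lintegral_const_mul _ (G.measurable_condDensity _).ennreal_ofReal,
          lintegral_condDensity, mul_one]

variable {n : ℕ} (M : Kernel (Fin n → ℝ × EuclideanSpace ℝ (Fin d)) (EuclideanSpace ℝ (Fin d)))

/-- The law of the output of `M` on independent observations, the `i`-th one with its own parameter
`θ i`. -/
noncomputable def outputLaw (θ : Fin n → EuclideanSpace ℝ (Fin d)) :
    Measure (EuclideanSpace ℝ (Fin d)) :=
  (Measure.pi fun i => G.law (θ i)).bind M

theorem risk_eq_lintegral_outputLaw (β : EuclideanSpace ℝ (Fin d)) :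
    G.risk M β = ∫⁻ w, ENNReal.ofReal (‖w - β‖ ^ 2) ∂(G.outputLaw M fun _ => β) := by
  have hloss : Measurable fun w : EuclideanSpace ℝ (Fin d) => ENNReal.ofReal (‖w - β‖ ^ 2) := by
    fun_prop
  rw [outputLaw, Measure.lintegral_bind M.measurable.aemeasurable hloss.aemeasurable]
  rfl

variable {M}

theorem measureReal_outputLaw_le_div_sq {β : EuclideanSpace ℝ (Fin d)} {ρ : ℝ≥0}
    (hρ : G.risk M β ≤ ρ) {r : ℝ} (hr : 0 < r) :
    (G.outputLaw M fun _ => β).real {w | r ≤ ‖w - β‖} ≤ ρ / r ^ 2 := by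
  refine ENNReal.toReal_le_of_le_ofReal (by positivity) ?_
  rw [ENNReal.ofReal_div_of_pos (by positivity), ENNReal.ofReal_coe_nnreal]
  calc (G.outputLaw M fun _ => β) {w | r ≤ ‖w - β‖}
      ≤ (G.outputLaw M fun _ => β)
          {w | ENNReal.ofReal (r ^ 2) ≤ ENNReal.ofReal (‖w - β‖ ^ 2)} :=
        measure_mono fun w hw => ENNReal.ofReal_le_ofReal (pow_le_pow_left₀ hr.le hw 2)
    _ ≤ G.risk M β / ENNReal.ofReal (r ^ 2) := by
        rw [risk_eq_lintegral_outputLaw]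
        exact meas_ge_le_lintegral_div (by fun_prop) (by simpa using hr.ne') ENNReal.ofReal_ne_top
    _ ≤ ρ / ENNReal.ofReal (r ^ 2) := ENNReal.div_le_div_right hρ _

variable [IsMarkovKernel M]

instance (θ : Fin n → EuclideanSpace ℝ (Fin d)) : IsProbabilityMeasure (G.outputLaw M θ) := by
  refine ⟨?_⟩
  rw [outputLaw, Measure.bind_apply MeasurableSet.univ M.measurable.aemeasurable]
  simp

theorem isPrivateFamily_outputLaw {ε δ : ℝ} (hM : IsDifferentiallyPrivate M ε δ) (hδ : 0 ≤ δ) :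
    IsPrivateFamily (G.outputLaw M) (Real.exp ε) δ := fun θ θ' i h S hS => by
  refine ENNReal.toReal_le_of_le_ofReal (by positivity) ?_
  rw [ENNReal.ofReal_add (by positivity) hδ, ENNReal.ofReal_mul (Real.exp_nonneg _),
    ofReal_measureReal]
  exact hM.bind_pi_le _ _ i (fun j hj => by rw [h j hj]) hS

theorem measureReal_outputLaw_le_mul_add {c₂ B : ℝ} (hψ : ∀ u, |deriv (deriv G.ψ) u| ≤ c₂)
    {θ : Fin n → EuclideanSpace ℝ (Fin d)} {β : EuclideanSpace ℝ (Fin d)}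
    (hx : ∀ i, ∀ᵐ x ∂G.design, |⟪x, θ i - β⟫_ℝ| ≤ B) {T : ℝ} (hT : 0 < T)
    {S : Set (EuclideanSpace ℝ (Fin d))} (hS : MeasurableSet S) :
    (G.outputLaw M θ).real S ≤ T * (G.outputLaw M fun _ => β).real S +
      Real.exp (n * (c₂ * B ^ 2 / G.c G.σ)) / T := by
  have hρ : ∀ i, Measurable fun z => ENNReal.ofReal (G.likelihoodRatio β (θ i) z) := fun i =>
    (G.measurable_likelihoodRatio β (θ i)).ennreal_ofReal
  have hprod : Measurable fun X : Fin n → ℝ × EuclideanSpace ℝ (Fin d) =>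
      ∏ i, ENNReal.ofReal (G.likelihoodRatio β (θ i) (X i)) :=
    Finset.measurable_fun_prod _ fun i _ => (hρ i).comp (measurable_pi_apply i)
  have hprob : ∀ i, IsProbabilityMeasure
      ((G.law β).withDensity fun z => ENNReal.ofReal (G.likelihoodRatio β (θ i) z)) := fun i => by
    rw [← law_eq_withDensity]
    infer_instance
  have hpi : (Measure.pi fun i => G.law (θ i)) = (Measure.pi fun _ : Fin n => G.law β).withDensity
      fun X => ∏ i, ENNReal.ofReal (G.likelihoodRatio β (θ i) (X i)) := by
    rw [← pi_withDensity_prod _ hρ]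
    simp_rw [← law_eq_withDensity]
  have hsecond : ∫⁻ X, (∏ i, ENNReal.ofReal (G.likelihoodRatio β (θ i) (X i))) ^ 2
      ∂(Measure.pi fun _ : Fin n => G.law β) ≤
        ENNReal.ofReal (Real.exp (n * (c₂ * B ^ 2 / G.c G.σ))) := by
    simp_rw [← Finset.prod_pow]
    rw [lintegral_pi_prod _ fun i => (hρ i).pow_const 2, Real.exp_nat_mul,
      ENNReal.ofReal_pow (Real.exp_nonneg _)]
    exact (Finset.prod_le_prod' fun i _ => G.lintegral_likelihoodRatio_sq_le hψ (hx i)).trans_eq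
      (by simp)
  refine ENNReal.toReal_le_of_le_ofReal (by positivity) ?_
  rw [ENNReal.ofReal_add (by positivity) (by positivity), ENNReal.ofReal_mul hT.le,
    ofReal_measureReal, ENNReal.ofReal_div_of_pos hT, outputLaw, outputLaw,
    Measure.bind_apply hS M.measurable.aemeasurable,
    Measure.bind_apply hS M.measurable.aemeasurable, hpi]
  refine (lintegral_withDensity_le_add_div hprod (M.measurable_coe hS) (fun X => prob_le_one)
    (by simpa using hT) ENNReal.ofReal_ne_top).trans ?_
  gcongr

theorem exists_radius_measureReal_outputLaw_le {c₂ B α : ℝ}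
    (hψ : ∀ u, |deriv (deriv G.ψ) u| ≤ c₂) {v : EuclideanSpace ℝ (Fin d)}
    (hx : ∀ᵐ x ∂G.design, |⟪x, v⟫_ℝ| ≤ B) {ρ : ℝ≥0} (hρ : ∀ b : ℝ, G.risk M (b • v) ≤ ρ)
    (hα : 0 < α) (D : ℝ) :
    ∃ r, ∀ (t : Fin n → ℝ) (b : ℝ), (∀ i, |t i - b| ≤ D) →
      (G.outputLaw M fun i => t i • v).real {w | r < ‖w - b • v‖} ≤ α := by
  set χ := Real.exp (n * (c₂ * (D * B) ^ 2 / G.c G.σ))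
  have hχ : 0 < χ := Real.exp_pos _
  set T := 2 * χ / α
  have hT : 0 < T := by positivity
  set r := 2 * T * ρ / α + 1
  have hr : 0 < r := by positivity
  refine ⟨r, fun t b htb => ?_⟩
  have hxt : ∀ i, ∀ᵐ x ∂G.design, |⟪x, t i • v - b • v⟫_ℝ| ≤ D * B := fun i => by
    filter_upwards [hx] with x hxB
    rw [← sub_smul, real_inner_smul_right, abs_mul]
    exact mul_le_mul (htb i) hxB (abs_nonneg _) ((abs_nonneg _).trans (htb i))
  have hsub : {w | r < ‖w - b • v‖} ⊆ {w | r ≤ ‖w - b • v‖} :=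
    Set.ofPred_subset_ofPred.2 fun _ => le_of_lt
  have hmarkov : (G.outputLaw M fun _ => b • v).real {w | r < ‖w - b • v‖} ≤ ρ / r ^ 2 :=
    (measureReal_mono hsub).trans
      (G.measureReal_outputLaw_le_div_sq (hρ b) hr)
  have hfar : T * (ρ / r ^ 2) ≤ α / 2 := by
    have hrr : 2 * T * ρ / α ≤ r ^ 2 := by
      have : 0 ≤ 2 * T * ρ / α := by positivity
      nlinarith
    rw [div_le_iff₀ hα] at hrr
    rw [mul_div_assoc', div_le_iff₀ (by positivity)]
    linarith
  calc (G.outputLaw M fun i => t i • v).real {w | r < ‖w - b • v‖}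
      ≤ T * (ρ / r ^ 2) + χ / T :=
        (G.measureReal_outputLaw_le_mul_add hψ hxt hT
          (measurableSet_lt measurable_const (by fun_prop))).trans (by gcongr)
    _ ≤ α / 2 + α / 2 := add_le_add hfar (by simp only [T]; field_simp; rfl)
    _ = α := add_halves α

theorem iSup_risk_smul_eq_top {c₂ B ε δ : ℝ} (hψ : ∀ u, |deriv (deriv G.ψ) u| ≤ c₂)
    {v : EuclideanSpace ℝ (Fin d)} (hv : ‖v‖ = 1) (hx : ∀ᵐ x ∂G.design, |⟪x, v⟫_ℝ| ≤ B)
    (hM : IsDifferentiallyPrivate M ε δ) (hδ : 0 ≤ δ) (hnδ : n * ((1 + Real.exp ε) * δ) < 1 / 2) :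
    ⨆ b : ℝ, G.risk M (b • v) = ⊤ := by
  by_contra htop
  lift ⨆ b : ℝ, G.risk M (b • v) to ℝ≥0 using htop with ρ hρ
  obtain ⟨α, hα, hα'⟩ := exists_between (sub_pos.2 hnδ)
  have hproj : Measurable fun w : EuclideanSpace ℝ (Fin d) => ⟪v, w⟫_ℝ := by fun_prop
  let Q : (Fin n → ℝ) → Measure ℝ := fun t =>
    (G.outputLaw M fun i => t i • v).map fun w => ⟪v, w⟫_ℝ
  have hQ : ∀ t, IsProbabilityMeasure (Q t) := fun t =>
    Measure.isProbabilityMeasure_map hproj.aemeasurable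
  have hprivate : IsPrivateFamily Q (Real.exp ε) δ :=
    (G.isPrivateFamily_outputLaw hM hδ).map_comp (· • v) hproj
  refine hprivate.not_accurate (Real.exp_nonneg ε) (lt_sub_iff_add_lt'.1 hα') fun D => ?_
  obtain ⟨r, hr⟩ := G.exists_radius_measureReal_outputLaw_le hψ hx
    (fun b => (le_iSup _ b).trans_eq hρ.symm) hα D
  refine ⟨r, fun t b htb => ?_⟩
  rw [map_measureReal_apply hproj (measurableSet_lt measurable_const (by fun_prop))]
  refine (measureReal_mono (Set.ofPred_subset_ofPred.2 fun w hw => hw.trans_le ?_)).trans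
    (hr t b htb)
  have hinner : ⟪v, w⟫_ℝ - b = ⟪v, w - b • v⟫_ℝ := by
    rw [inner_sub_right, real_inner_smul_right, real_inner_self_eq_norm_sq, hv, one_pow, mul_one]
  rw [hinner]
  simpa [hv] using abs_real_inner_le_norm v (w - b • v)

theorem norm_sub_sq_div_le_of_risk_le {c₂ B : ℝ} (hψ : ∀ u, |deriv (deriv G.ψ) u| ≤ c₂)
    {β β' : EuclideanSpace ℝ (Fin d)} (hx : ∀ᵐ x ∂G.design, |⟪x, β' - β⟫_ℝ| ≤ B) {ρ : ℝ≥0}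
    (hρ : G.risk M β ≤ ρ) (hρ' : G.risk M β' ≤ ρ) :
    ‖β' - β‖ ^ 2 / (24 * Real.exp (n * (c₂ * B ^ 2 / G.c G.σ))) ≤ ρ := by
  set τ := ‖β' - β‖
  set χ := Real.exp (n * (c₂ * B ^ 2 / G.c G.σ))
  rcases (norm_nonneg (β' - β)).eq_or_lt with hτ | hτ
  · simp [τ, ← hτ]
  have hc := G.c_pos
  have hc₂ : 0 ≤ c₂ := (abs_nonneg _).trans (hψ 0)
  have hχ : 1 ≤ χ := Real.one_le_exp (by positivity)
  set A : Set (EuclideanSpace ℝ (Fin d)) := {w | τ / 2 ≤ ‖w - β'‖}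
  have hA : MeasurableSet A := measurableSet_le measurable_const (by fun_prop)
  have hAc : Aᶜ ⊆ {w | τ / 2 ≤ ‖w - β‖} := fun w hw => by
    have hwA : ‖w - β'‖ < τ / 2 := not_le.1 hw
    have htri : τ ≤ ‖w - β'‖ + ‖w - β‖ := by
      rw [norm_sub_rev w β']
      exact norm_sub_le_norm_sub_add_norm_sub β' w β
    change τ / 2 ≤ ‖w - β‖
    linarith
  have hclose' : 1 - ρ / (τ / 2) ^ 2 ≤ (G.outputLaw M fun _ => β').real Aᶜ := by
    rw [probReal_compl_eq_one_sub hA]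
    linarith [G.measureReal_outputLaw_le_div_sq hρ' (half_pos hτ)]
  have hclose : (G.outputLaw M fun _ => β).real Aᶜ ≤ ρ / (τ / 2) ^ 2 :=
    (measureReal_mono hAc).trans (G.measureReal_outputLaw_le_div_sq hρ (half_pos hτ))
  have hcompare : (G.outputLaw M fun _ => β').real Aᶜ ≤ 2 * χ * (ρ / (τ / 2) ^ 2) + 1 / 2 := by
    refine (G.measureReal_outputLaw_le_mul_add hψ (fun _ => hx) (T := 2 * χ) (by positivity)
      hA.compl).trans (add_le_add (by gcongr) (le_of_eq ?_))
    change χ / (2 * χ) = 1 / 2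
    field_simp
  have hhalf : 1 / 2 ≤ 3 * χ * (ρ / (τ / 2) ^ 2) := by
    have : ρ / (τ / 2) ^ 2 ≤ χ * (ρ / (τ / 2) ^ 2) := le_mul_of_one_le_left (by positivity) hχ
    linarith
  rw [div_pow, div_div_eq_mul_div, mul_div_assoc', le_div_iff₀ (by positivity)] at hhalf
  rw [div_le_iff₀ (by positivity)]
  linarith

section Sparse

variable (j : Fin d)

theorem hammingNorm_smul_single_le_one (b : ℝ) :
    hammingNorm (fun k => (b • EuclideanSpace.single j (1 : ℝ)) k) ≤ 1 := by
  rw [hammingNorm, ← Finset.card_singleton j]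
  refine Finset.card_le_card fun k hk => ?_
  by_contra hkj
  simp_all

theorem le_privateMinimaxRisk_of_forall {s : ℕ} (hs : 1 ≤ s) {ε δ : ℝ} {ρ : ℝ≥0∞}
    (h : ∀ (M : Kernel (Fin n → ℝ × EuclideanSpace ℝ (Fin d)) (EuclideanSpace ℝ (Fin d)))
      [IsMarkovKernel M], IsDifferentiallyPrivate M ε δ →
        ρ ≤ ⨆ b : ℝ, G.risk M (b • EuclideanSpace.single j (1 : ℝ))) :
    ρ ≤ G.privateMinimaxRisk n s ε δ :=
  le_iInf fun M => le_iInf fun _ => le_iInf fun hM => (h M hM).trans <| iSup_le fun b =>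
    le_iSup₂_of_le (b • EuclideanSpace.single j (1 : ℝ))
      ((hammingNorm_smul_single_le_one j b).trans hs) le_rfl

variable {j} {c₁ c₂ : ℝ}

theorem privateMinimaxRisk_eq_top {s : ℕ} (hs : 1 ≤ s) {ε δ : ℝ}
    (hx : ∀ᵐ x ∂G.design, |x j| ≤ c₁) (hψ : ∀ u, |deriv (deriv G.ψ) u| ≤ c₂) (hδ : 0 ≤ δ)
    (hnδ : n * ((1 + Real.exp ε) * δ) < 1 / 2) :
    G.privateMinimaxRisk n s ε δ = ⊤ :=
  top_le_iff.1 <| G.le_privateMinimaxRisk_of_forall j hs fun M _ hM =>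
    (G.iSup_risk_smul_eq_top (B := c₁) hψ (by simp)
      (by simpa [EuclideanSpace.inner_single_right] using hx) hM hδ hnδ).ge

theorem ofReal_div_le_privateMinimaxRisk (n : ℕ) {s : ℕ} (hs : 1 ≤ s) (ε δ : ℝ)
    (hx : ∀ᵐ x ∂G.design, |x j| ≤ c₁) (hψ : ∀ u, |deriv (deriv G.ψ) u| ≤ c₂) :
    ENNReal.ofReal (G.c G.σ / (24 * Real.exp (n * (c₂ * c₁ ^ 2)))) ≤
      G.privateMinimaxRisk n s ε δ := by
  refine G.le_privateMinimaxRisk_of_forall j hs fun M _ _ => ?_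
  set v : EuclideanSpace ℝ (Fin d) := EuclideanSpace.single j (1 : ℝ)
  rcases eq_or_ne (⨆ b : ℝ, G.risk M (b • v)) ⊤ with htop | htop
  · exact htop ▸ le_top
  lift ⨆ b : ℝ, G.risk M (b • v) to ℝ≥0 using htop with ρ hρ
  have hc := G.c_pos
  have hx' : ∀ᵐ x ∂G.design, |⟪x, √(G.c G.σ) • v - (0 : ℝ) • v⟫_ℝ| ≤ √(G.c G.σ) * c₁ := by
    filter_upwards [hx] with x hxj
    simpa [v, EuclideanSpace.inner_single_right, real_inner_smul_right, abs_mul,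
      abs_of_nonneg (Real.sqrt_nonneg (G.c G.σ))] using
      mul_le_mul_of_nonneg_left hxj (Real.sqrt_nonneg (G.c G.σ))
  have htwo := G.norm_sub_sq_div_le_of_risk_le hψ hx' ((le_iSup _ 0).trans_eq hρ.symm)
    ((le_iSup _ √(G.c G.σ)).trans_eq hρ.symm)
  have hnorm : ‖√(G.c G.σ) • v - (0 : ℝ) • v‖ ^ 2 = G.c G.σ := by
    simp [v, norm_smul, Real.sq_sqrt hc.le]
  have hexponent : c₂ * (√(G.c G.σ) * c₁) ^ 2 / G.c G.σ = c₂ * c₁ ^ 2 := by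
    rw [mul_pow, Real.sq_sqrt hc.le]
    field_simp
  rw [hnorm, hexponent] at htwo
  rw [← ENNReal.ofReal_coe_nnreal]
  exact ENNReal.ofReal_le_ofReal htwo

end Sparse

end GLM

theorem exists_forall_mul_rpow_le {γ η : ℝ} (K : ℝ) (hγ : 0 < γ) (hη : 0 < η) :
    ∃ N : ℕ, ∀ n : ℕ, 1 ≤ n → N ≤ n → n * (K * (n : ℝ) ^ (-(1 + γ))) ≤ η := by
  have hlim : Filter.Tendsto (fun n : ℕ => K * (n : ℝ) ^ (-γ)) Filter.atTop (nhds (K * 0)) :=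
    ((tendsto_rpow_neg_atTop hγ).comp tendsto_natCast_atTop_atTop).const_mul K
  rw [mul_zero] at hlim
  obtain ⟨N, hN⟩ := Filter.eventually_atTop.1 (hlim.eventually_le_const hη)
  refine ⟨N, fun n hn hNn => ?_⟩
  have hn0 : (0 : ℝ) < n := by exact_mod_cast hn
  rw [neg_add, Real.rpow_add hn0, Real.rpow_neg_one, mul_left_comm, mul_inv_cancel_left₀ hn0.ne']
  exact hN n hNn

theorem exists_forall_mul_one_add_exp_mul_lt_half {γ : ℝ} (K E : ℝ) (hγ : 0 < γ) :
    ∃ N : ℕ, ∀ (n : ℕ) (ε δ : ℝ), 1 ≤ n → N ≤ n → ε ≤ E → 0 ≤ δ →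
      δ ≤ K * (n : ℝ) ^ (-(1 + γ)) → n * ((1 + Real.exp ε) * δ) < 1 / 2 := by
  obtain ⟨N, hN⟩ := exists_forall_mul_rpow_le K hγ
    (by positivity : 0 < 1 / (4 * (1 + Real.exp E)))
  refine ⟨N, fun n ε δ hn hNn hεE hδ hδn => ?_⟩
  calc n * ((1 + Real.exp ε) * δ) = (1 + Real.exp ε) * (n * δ) := by ring
    _ ≤ (1 + Real.exp E) * (1 / (4 * (1 + Real.exp E))) := by
        gcongr
        exact (mul_le_mul_of_nonneg_left hδn n.cast_nonneg).trans (hN n hn hNn)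
    _ = 1 / 4 := by field_simp
    _ < 1 / 2 := by norm_num

theorem div_add_sq_div_le {L K m ε E : ℝ} (hL : 0 ≤ L) (hm : 0 < m) (hε : 0 < ε) (hεE : ε ≤ E)
    (hLK : L ≤ K * (m * ε)) : L / m + L ^ 2 / (m ^ 2 * ε ^ 2) ≤ K * E + K ^ 2 := by
  have hK : 0 ≤ K := nonneg_of_mul_nonneg_left (hL.trans hLK) (by positivity)
  refine add_le_add ?_ ?_
  · rw [div_le_iff₀ hm]
    calc L ≤ K * (m * ε) := hLK
      _ ≤ K * (m * E) := by gcongr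
      _ = K * E * m := by ring
  · rw [div_le_iff₀ (by positivity), ← mul_pow, ← mul_pow]
    exact pow_le_pow_left₀ hL hLK 2

theorem theorem5p1_general (γ₂ K₁ K₂ c₁ c₂ E : ℝ) (hγ₂ : 0 < γ₂) :
    ∃ c₀ : ℝ, 0 < c₀ ∧
      ∀ (n d s : ℕ) (ε δ : ℝ) (G : GLM d) (j : Fin d),
        1 ≤ n → 1 ≤ s → s ≤ d →
        (∀ᵐ x ∂G.design, |x j| ≤ c₁) →
        (∀ u : ℝ, |deriv (deriv G.ψ) u| ≤ c₂) →
        0 < ε → ε ≤ E → 0 ≤ δ →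
        (s : ℝ) * Real.log ((d : ℝ) / s) ≤ K₁ * (n * ε) →
        δ ≤ K₂ * (n : ℝ) ^ (-(1 + γ₂)) →
        ENNReal.ofReal (c₀ * (G.c G.σ *
            ((s : ℝ) * Real.log ((d : ℝ) / s) / n
              + ((s : ℝ) * Real.log ((d : ℝ) / s)) ^ 2 / ((n : ℝ) ^ 2 * ε ^ 2))))
          ≤ G.privateMinimaxRisk n s ε δ := by
  obtain ⟨N, hN⟩ := exists_forall_mul_one_add_exp_mul_lt_half K₂ E hγ₂
  set χ := Real.exp (N * (c₂ * c₁ ^ 2))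
  have hχ : 0 < χ := Real.exp_pos _
  refine ⟨1 / (24 * χ * (|K₁ * E| + K₁ ^ 2 + 1)), by positivity, ?_⟩
  intro n d s ε δ G j hn hs hsd hx hψ hε hεE hδ hL hδn
  have hn0 : (0 : ℝ) < n := by exact_mod_cast hn
  have hs0 : (0 : ℝ) < s := by exact_mod_cast hs
  have hc := G.c_pos
  have hc₂ : 0 ≤ c₂ := (abs_nonneg _).trans (hψ 0)
  rcases le_or_gt N n with hNn | hnN
  · exact le_top.trans_eq
      (G.privateMinimaxRisk_eq_top hs hx hψ hδ (hN n ε δ hn hNn hεE hδ hδn)).symm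
  · refine (ENNReal.ofReal_le_ofReal ?_).trans
      (G.ofReal_div_le_privateMinimaxRisk n hs ε δ hx hψ)
    have hL0 : 0 ≤ (s : ℝ) * Real.log ((d : ℝ) / s) :=
      mul_nonneg hs0.le (Real.log_nonneg ((one_le_div hs0).2 (by exact_mod_cast hsd)))
    have hrate := (div_add_sq_div_le hL0 hn0 hε hεE hL).trans
      ((add_le_add_left (le_abs_self _) _).trans (le_add_of_nonneg_right zero_le_one))
    have hexp : Real.exp (n * (c₂ * c₁ ^ 2)) ≤ χ :=
      Real.exp_le_exp.2 (mul_le_mul_of_nonneg_right (Nat.cast_le.2 hnN.le) (by positivity))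
    calc _ ≤ 1 / (24 * χ * (|K₁ * E| + K₁ ^ 2 + 1)) *
          (G.c G.σ * (|K₁ * E| + K₁ ^ 2 + 1)) :=
          mul_le_mul_of_nonneg_left (mul_le_mul_of_nonneg_left hrate hc.le) (by positivity)
      _ = G.c G.σ / (24 * χ) := by field_simp
      _ ≤ G.c G.σ / (24 * Real.exp (n * (c₂ * c₁ ^ 2))) := by gcongr

theorem theorem5p1
    (γ₁ γ₂ κ K₁ K₂ C c₁ c₂ : ℝ)
    (hγ₁ : 0 < γ₁) (hγ₂ : 0 < γ₂) (hκ : 0 < κ) (hK₁ : 0 < K₁) (hK₂ : 0 < K₂)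
    (hC : 0 < C) (hc₁ : 0 < c₁) (hc₂ : 0 < c₂) :
    ∃ c₀ : ℝ, 0 < c₀ ∧
      ∀ (n d s : ℕ) (ε δ : ℝ) (G : GLM d),
        1 ≤ n → 1 ≤ s → s ≤ d →
        (s : ℝ) ≤ κ * (d : ℝ) ^ (1 - γ₁) →
        G.secondMoment.IsDiag →
        (∀ μ : ℝ, Module.End.HasEigenvalue (Matrix.toLin' G.secondMoment) μ → μ < C) →
        (∀ᵐ x ∂G.design, ∀ j, |x j| < c₁) →
        (∀ u : ℝ, |deriv (deriv G.ψ) u| ≤ c₂) →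
        0 < ε → ε < 1 → 0 ≤ δ →
        (s : ℝ) * Real.log ((d : ℝ) / s) ≤ K₁ * (n * ε) →
        δ ≤ K₂ * (n : ℝ) ^ (-(1 + γ₂)) →
        ENNReal.ofReal (c₀ * (G.c G.σ *
            ((s : ℝ) * Real.log ((d : ℝ) / s) / n
              + ((s : ℝ) * Real.log ((d : ℝ) / s)) ^ 2 / ((n : ℝ) ^ 2 * ε ^ 2))))
          ≤ G.privateMinimaxRisk n s ε δ := by
  obtain ⟨c₀, hc₀, h⟩ := theorem5p1_general γ₂ K₁ K₂ c₁ c₂ 1 hγ₂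
  exact ⟨c₀, hc₀, fun n d s ε δ G hn hs hsd _ _ _ hx hψ hε hε1 hδ hL hδn =>
    h n d s ε δ G ⟨0, by omega⟩ hn hs hsd (hx.mono fun x hx => (hx _).le) hψ hε hε1.le hδ hL hδn⟩
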